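/- Let $\mathbb H$ be the quaternions. A right quaternionic Hilbert space is a right $\mathbb H$-vector space $V$ with a map $\langle\cdot\mid\cdot\rangle:V\times V\to\mathbb H$ that satisfies $\overline{\langle\phi\mid\psi\rangle}=\langle\psi\mid\phi\rangle$, is additive in the second variable, satisfies $\langle\phi\mid\psi q\rangle=\langle\phi\mid\psi\rangle q$ and $\langle\phi q\mid\psi\rangle=\overline q\,\langle\phi\mid\psi\rangle$ for $q\in\mathbb H$, and for which $\langle\phi\mid\phi\rangle$ is real and positive for $\phi\neq0$, such that $V$ is complete and separable for the norm $\|\phi\|=\langle\phi\mid\phi\rangle^{1/2}$. For right quaternionic Hilbert spaces $V$ and $U$, let $B(V,U)$ be the set of bounded right $\mathbb H$-linear operators $A:V\to U$, with norm $\|A\|=\sup_{\|\phi\|=1}\|A\phi\|$ (equal to $0$ if $V=\{0\}$). An operator $A\in B(V,U)$ is called Fredholm if $\ker A$ and $\operatorname{coker}A=U/\operatorname{ran}A$ are finite dimensional over $\mathbb H$; its index is then the integer $\operatorname{ind}(A)=\dim_{\mathbb H}(\ker A)-\dim_{\mathbb H}(\operatorname{coker}A)$. **Theorem.** Let $A\in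 B(V,U)$ be a Fredholm operator. Then there exists a constant $c>0$ such that for every operator $S\in B(V,U)$ with $\|S\|<c$, the operator $A+S$ is Fredholm and $\operatorname{ind}(A+S)=\operatorname{ind}(A)$. -/

import Mathlib

open scoped Quaternion

/-- Inner product structure on a right quaternionic vector space `V`. The right scalar
multiplication `φ q` is `MulOpposite.op q • φ`; the inner product is `ℍ`-valued, right linear in
the second variable, and induces the norm. Positive definiteness is part of
`NormedAddCommGroup V` together with `inner_self`. A right quaternionic Hilbert space is such a
space which is in addition complete and separable. -/
class RightQuaternionicInnerProductSpace (V : Type*) [NormedAddCommGroup V] extends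
    Module ℍᵐᵒᵖ V, Inner ℍ V where
  star_inner : ∀ φ ψ : V, star (inner φ ψ) = inner ψ φ
  inner_self : ∀ φ : V, inner φ φ = ((‖φ‖ ^ 2 : ℝ) : ℍ)
  inner_add_right : ∀ φ ψ ω : V, inner φ (ψ + ω) = inner φ ψ + inner φ ω
  inner_smul_right : ∀ (φ ψ : V) (q : ℍ), inner φ (MulOpposite.op q • ψ) = inner φ ψ * q
  inner_smul_left : ∀ (φ ψ : V) (q : ℍ), inner (MulOpposite.op q • φ) ψ = star q * inner φ ψ

namespace QuaternionicOperator

variable {V U : Type*} [NormedAddCommGroup V] [RightQuaternionicInnerProductSpace V]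
  [NormedAddCommGroup U] [RightQuaternionicInnerProductSpace U]

/-- The operator norm `‖A‖ = sup_{‖φ‖ = 1} ‖A φ‖` of a bounded (i.e. continuous) right linear
operator. On the zero space it is `0`. -/
noncomputable def opNorm (A : V →L[ℍᵐᵒᵖ] U) : ℝ :=
  sSup {r : ℝ | ∃ φ : V, ‖φ‖ = 1 ∧ r = ‖A φ‖}

/-- `A` is Fredholm: `ker A` and `coker A = U / ran A` are finite dimensional over `ℍ`
(acting on the right). -/
def IsFredholm (A : V →L[ℍᵐᵒᵖ] U) : Prop :=
  FiniteDimensional ℍᵐᵒᵖ (LinearMap.ker (A : V →ₗ[ℍᵐᵒᵖ] U)) ∧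
    FiniteDimensional ℍᵐᵒᵖ (U ⧸ LinearMap.range (A : V →ₗ[ℍᵐᵒᵖ] U))

/-- `ind A = dim (ker A) - dim (coker A)`, meaningful for Fredholm `A`. -/
noncomputable def index (A : V →L[ℍᵐᵒᵖ] U) : ℤ :=
  (Module.finrank ℍᵐᵒᵖ (LinearMap.ker (A : V →ₗ[ℍᵐᵒᵖ] U)) : ℤ) -
    (Module.finrank ℍᵐᵒᵖ (U ⧸ LinearMap.range (A : V →ₗ[ℍᵐᵒᵖ] U)) : ℤ)

theorem norm_op_smul (φ : V) (q : ℍ) : ‖MulOpposite.op q • φ‖ = ‖φ‖ * ‖q‖ := by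
  have h := RightQuaternionicInnerProductSpace.inner_self (MulOpposite.op q • φ)
  rw [RightQuaternionicInnerProductSpace.inner_smul_right,
    RightQuaternionicInnerProductSpace.inner_smul_left,
    RightQuaternionicInnerProductSpace.inner_self, mul_assoc,
    (Quaternion.coe_commutes _ q), ← mul_assoc, Quaternion.star_mul_self,
    ← Quaternion.coe_mul, Quaternion.coe_inj, Quaternion.normSq_eq_norm_mul_self] at h
  have h2 : ‖MulOpposite.op q • φ‖ ^ 2 = (‖φ‖ * ‖q‖) ^ 2 := by rw [← h]; ring
  exact (pow_left_inj₀ (norm_nonneg _) (by positivity) two_ne_zero).1 h2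

/-- Continuous right linear operators are bounded, so the supremum `opNorm A` is a genuine one. -/
theorem bddAbove_opNorm (A : V →L[ℍᵐᵒᵖ] U) :
    BddAbove {r : ℝ | ∃ φ : V, ‖φ‖ = 1 ∧ r = ‖A φ‖} := by
  have hc : ContinuousAt A 0 := A.continuous.continuousAt
  obtain ⟨δ, hδ, h⟩ := Metric.continuousAt_iff.1 hc 1 one_pos
  refine ⟨2 / δ, ?_⟩
  rintro _ ⟨φ, hφ, rfl⟩
  have hq : ‖((δ / 2 : ℝ) : ℍ)‖ = δ / 2 := by
    rw [Quaternion.norm_coe, Real.norm_of_nonneg (by positivity)]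
  have h1 := @h (MulOpposite.op ((δ / 2 : ℝ) : ℍ) • φ) (by
    rw [dist_zero_right, norm_op_smul, hφ, hq]; linarith)
  rw [map_zero, dist_zero_right, map_smul, norm_op_smul, hq] at h1
  rw [le_div_iff₀ hδ]
  linarith

end QuaternionicOperator

/-! The problem reduces to real Banach spaces: restricting scalars from `ℍᵐᵒᵖ` to `ℝ` leaves kernel
and cokernel unchanged as sets and multiplies their dimensions by 4, so the real index is four times
the quaternionic one. Over `ℝ`, let `p` be a closed complement of `ker A` and `W` a complement of
`ran A`, and put `T B (v, w) = B v + w` on `p × W`. `T A` is bijective, hence an isomorphism by the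
open mapping theorem. Isomorphisms form an open set and `T` is continuous, so `T (A + S)` is
invertible for small `S`. Whenever `T B` is invertible, linear algebra gives `ind B = codim p - dim
W`, which does not depend on `B`. -/

open Module in
/-- If `B` is injective on `p` and `B(p) ⊕ W` is the whole target, where `p` has finite codimension
and `W` has finite dimension, then the index of `B` is `codim p - dim W`. -/
theorem LinearMap.finrank_ker_add_of_equiv_prod {K E F : Type*} [Field K] [AddCommGroup E]
    [Module K E] [AddCommGroup F] [Module K F] (B : E →ₗ[K] F) (p : Submodule K E)
    (W : Submodule K F) [FiniteDimensional K (E ⧸ p)] [FiniteDimensional K W]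
    (T : (p × W) ≃ₗ[K] F) (hT : ∀ x, T x = B x.1 + x.2) :
    FiniteDimensional K (ker B) ∧ FiniteDimensional K (F ⧸ range B) ∧
      finrank K (ker B) + finrank K W = finrank K (F ⧸ range B) + finrank K (E ⧸ p) := by
  -- The projection of `F` onto `W` along `B(p)`.
  let π : F →ₗ[K] W := LinearMap.snd K p W ∘ₗ T.symm.toLinearMap
  have hπ0 : ∀ v : p, π (B v) = 0 := fun v => by
    have : T.symm (B v) = (v, 0) := by rw [LinearEquiv.symm_apply_eq, hT]; simp
    simp [π, this]
  have hπW : ∀ w : W, π w = w := fun w => by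
    have : T.symm (w : F) = (0, w) := by rw [LinearEquiv.symm_apply_eq, hT]; simp
    simp [π, this]
  have hπker : ∀ y, π y = 0 → ∃ v : p, B v = y := fun y hy => by
    refine ⟨(T.symm y).1, ?_⟩
    have h := hT (T.symm y)
    rw [T.apply_symm_apply, show (T.symm y).2 = 0 from hy] at h
    simpa using h.symm
  -- `f` is a finite-dimensional model of `B`: its kernel and cokernel turn out to be isomorphic to
  -- those of `B`, so rank-nullity for `f` gives the index.
  let f : (E ⧸ p) →ₗ[K] W := p.liftQ (π ∘ₗ B) fun v hv => hπ0 ⟨v, hv⟩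
  have hf : ∀ x, f (p.mkQ x) = π (B x) := fun _ => rfl
  let i : ker B →ₗ[K] E ⧸ p := p.mkQ ∘ₗ (ker B).subtype
  have hi : Function.Injective i := by
    rw [injective_iff_map_eq_zero]
    rintro ⟨x, hx⟩ h
    have hxp : x ∈ p := by simpa [i] using h
    have h0 : T (⟨x, hxp⟩, 0) = 0 := by rw [hT]; simpa using hx
    rw [T.map_eq_zero_iff] at h0
    simpa using h0
  have hri : range i = ker f := by
    ext z
    obtain ⟨x, rfl⟩ := p.mkQ_surjective z
    constructor
    · rintro ⟨⟨y, hy⟩, h⟩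
      rw [← h, LinearMap.mem_ker]
      exact (hf y).trans (by rw [LinearMap.mem_ker.1 hy, map_zero])
    · intro hx
      obtain ⟨v, hv⟩ := hπker (B x) (by rwa [← hf])
      -- Subtracting `v ∈ p` with `B v = B x` moves `x` into `ker B` without changing its class.
      refine ⟨⟨x - v, by simp [hv]⟩, ?_⟩
      simp [i]
  let q : F →ₗ[K] W ⧸ range f := (range f).mkQ ∘ₗ π
  have hq : Function.Surjective q :=
    (range f).mkQ_surjective.comp fun w => ⟨w, hπW w⟩
  have hkq : ker q = range B := by
    ext y
    constructor
    · intro hy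
      have hy' : π y ∈ range f := by simpa [q] using hy
      obtain ⟨z, hz⟩ := hy'
      obtain ⟨x, rfl⟩ := p.mkQ_surjective z
      obtain ⟨v, hv⟩ := hπker (y - B x) (by rw [map_sub, ← hz, hf, sub_self])
      exact ⟨v + x, by rw [map_add, hv]; simp⟩
    · rintro ⟨x, rfl⟩
      have : π (B x) ∈ range f := ⟨p.mkQ x, hf x⟩
      simpa [q] using this
  let e : (F ⧸ range B) ≃ₗ[K] W ⧸ range f :=
    (Submodule.quotEquivOfEq _ _ hkq.symm).trans (q.quotKerEquivOfSurjective hq)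
  refine ⟨FiniteDimensional.of_injective i hi, e.symm.finiteDimensional, ?_⟩
  have h1 := finrank_range_of_inj hi
  rw [hri] at h1
  have h2 := e.finrank_eq
  have h3 := f.finrank_range_add_finrank_ker
  have h4 := (range f).finrank_quotient_add_finrank
  omega

open Module in
/-- Stability of the index of Fredholm operators between real Banach spaces. -/
theorem ContinuousLinearMap.exists_forall_finrank_ker_add {E F : Type*} [NormedAddCommGroup E]
    [NormedSpace ℝ E] [CompleteSpace E] [NormedAddCommGroup F] [NormedSpace ℝ F] [CompleteSpace F]
    (A : E →L[ℝ] F) [FiniteDimensional ℝ (LinearMap.ker A.toLinearMap)]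
    [FiniteDimensional ℝ (F ⧸ LinearMap.range A.toLinearMap)] :
    ∃ c : ℝ, 0 < c ∧ ∀ S : E →L[ℝ] F, ‖S‖ < c →
      FiniteDimensional ℝ (LinearMap.ker (A + S).toLinearMap) ∧
      FiniteDimensional ℝ (F ⧸ LinearMap.range (A + S).toLinearMap) ∧
      finrank ℝ (LinearMap.ker (A + S).toLinearMap) +
          finrank ℝ (F ⧸ LinearMap.range A.toLinearMap) =
        finrank ℝ (F ⧸ LinearMap.range (A + S).toLinearMap) +
          finrank ℝ (LinearMap.ker A.toLinearMap) := by
  obtain ⟨p, hpc, hp⟩ := (Submodule.ClosedComplemented.of_finiteDimensional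
    (LinearMap.ker A.toLinearMap)).exists_isClosed_isCompl
  -- An algebraic complement is enough: `W` is finite dimensional, hence complete, and closedness of
  -- the range is never needed.
  obtain ⟨W, hW⟩ := (LinearMap.range A.toLinearMap).exists_isCompl
  let eW := Submodule.quotientEquivOfIsCompl _ _ hW
  let ep := Submodule.quotientEquivOfIsCompl _ _ hp.symm
  have : FiniteDimensional ℝ W := eW.finiteDimensional
  have : FiniteDimensional ℝ (E ⧸ p) := ep.symm.finiteDimensional
  have : CompleteSpace p := hpc.completeSpace_coe
  have : CompleteSpace W := FiniteDimensional.complete ℝ W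
  let T (B : E →L[ℝ] F) : (p × W) →L[ℝ] F := B ∘L p.subtypeL ∘L .fst ℝ p W + W.subtypeL ∘L .snd ℝ p W
  have hTc : Continuous T :=
    (continuous_id.clm_comp continuous_const).add continuous_const
  have hker : (T A).ker = ⊥ := by
    rw [LinearMap.ker_eq_bot']
    rintro ⟨v, w⟩ h
    have h' : A v + w = 0 := h
    have hAv : A v = 0 := by
      refine (Submodule.disjoint_def.1 hW.disjoint) _ ⟨v, rfl⟩ ?_
      rw [eq_neg_of_add_eq_zero_left h']
      exact W.neg_mem w.2
    have hv : (v : E) = 0 := (Submodule.disjoint_def.1 hp.disjoint) _ hAv v.2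
    rw [hAv, zero_add] at h'
    ext <;> simp [hv, h']
  have hran : (T A).range = ⊤ := by
    rw [LinearMap.range_eq_top]
    intro y
    obtain ⟨_, ⟨x, rfl⟩, w, hw, rfl⟩ :=
      Submodule.mem_sup.1 (hW.sup_eq_top ▸ Submodule.mem_top (x := y))
    obtain ⟨k, hk, v, hv, rfl⟩ :=
      Submodule.mem_sup.1 (hp.sup_eq_top ▸ Submodule.mem_top (x := x))
    refine ⟨(⟨v, hv⟩, ⟨w, hw⟩), ?_⟩
    have hk' : A k = 0 := hk
    simp [T, hk']
  -- The radius `c` is that of a ball around `A` on which `T` takes invertible values.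
  have hopen : IsOpen (T ⁻¹' Set.range ((↑) : ((p × W) ≃L[ℝ] F) → (p × W) →L[ℝ] F)) :=
    ContinuousLinearEquiv.isOpen.preimage hTc
  obtain ⟨c, hc, hball⟩ := Metric.isOpen_iff.1 hopen A
    ⟨ContinuousLinearEquiv.ofBijective (T A) hker hran, rfl⟩
  refine ⟨c, hc, fun S hS => ?_⟩
  obtain ⟨e, he⟩ := hball (show A + S ∈ Metric.ball A c by simpa [dist_eq_norm] using hS)
  obtain ⟨h1, h2, h3⟩ := LinearMap.finrank_ker_add_of_equiv_prod (A + S).toLinearMap p W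
    e.toLinearEquiv fun x => by
      change (e : (p × W) →L[ℝ] F) x = _
      rw [he]; rfl
  refine ⟨h1, h2, ?_⟩
  rw [eW.finrank_eq, ← ep.finrank_eq]
  exact h3

namespace QuaternionicOperator

variable (V : Type*) [NormedAddCommGroup V] [RightQuaternionicInnerProductSpace V]

/-- The real vector space underlying a right quaternionic vector space. -/
@[reducible]
noncomputable def realModule : Module ℝ V := Module.compHom V (algebraMap ℝ ℍᵐᵒᵖ)

attribute [local instance] realModule

theorem real_smul_eq (r : ℝ) (φ : V) : r • φ = MulOpposite.op (r : ℍ) • φ := rfl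

theorem isScalarTower_real : IsScalarTower ℝ ℍᵐᵒᵖ V where
  smul_assoc r q φ := by
    rw [Algebra.smul_def, mul_smul]
    rfl

/-- The real normed space underlying a right quaternionic inner product space. -/
@[reducible]
noncomputable def realNormedSpace : NormedSpace ℝ V where
  norm_smul_le r φ := by
    rw [real_smul_eq, norm_op_smul, Quaternion.norm_coe, mul_comm]

attribute [local instance] isScalarTower_real realNormedSpace

variable {V} {U : Type*} [NormedAddCommGroup U] [RightQuaternionicInnerProductSpace U]

theorem norm_apply_le_opNorm (A : V →L[ℍᵐᵒᵖ] U) (φ : V) : ‖A φ‖ ≤ opNorm A * ‖φ‖ := by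
  rcases eq_or_ne φ 0 with rfl | hφ
  · simp
  have hφ' : 0 < ‖φ‖ := norm_pos_iff.2 hφ
  have h : ‖A (MulOpposite.op ((‖φ‖⁻¹ : ℝ) : ℍ) • φ)‖ ≤ opNorm A := by
    refine le_csSup (bddAbove_opNorm A) ⟨_, ?_, rfl⟩
    rw [norm_op_smul, Quaternion.norm_coe, norm_inv, norm_norm, mul_inv_cancel₀ hφ'.ne']
  rwa [map_smul, norm_op_smul, Quaternion.norm_coe, norm_inv, norm_norm, ← div_eq_mul_inv,
    div_le_iff₀ hφ'] at h

theorem opNorm_nonneg (A : V →L[ℍᵐᵒᵖ] U) : 0 ≤ opNorm A :=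
  Real.sSup_nonneg (by rintro _ ⟨φ, -, rfl⟩; exact norm_nonneg _)

/-- This inequality alone lets the radius found for the real operator norm serve for `opNorm`. -/
theorem norm_restrictScalars_le_opNorm (A : V →L[ℍᵐᵒᵖ] U) : ‖A.restrictScalars ℝ‖ ≤ opNorm A :=
  ContinuousLinearMap.opNorm_le_bound _ (opNorm_nonneg A) (norm_apply_le_opNorm A)

theorem finiteDimensional_real : FiniteDimensional ℝ ℍᵐᵒᵖ :=
  (MulOpposite.opLinearEquiv ℝ : ℍ ≃ₗ[ℝ] ℍᵐᵒᵖ).finiteDimensional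

theorem finiteDimensional_iff_real {M : Type*} [AddCommGroup M] [Module ℍᵐᵒᵖ M] [Module ℝ M]
    [IsScalarTower ℝ ℍᵐᵒᵖ M] : FiniteDimensional ℍᵐᵒᵖ M ↔ FiniteDimensional ℝ M := by
  have := finiteDimensional_real
  exact ⟨fun _ => Module.Finite.trans ℍᵐᵒᵖ M, fun _ => Module.Finite.right ℝ ℍᵐᵒᵖ M⟩

theorem finrank_real {M : Type*} [AddCommGroup M] [Module ℍᵐᵒᵖ M] [Module ℝ M]
    [IsScalarTower ℝ ℍᵐᵒᵖ M] : Module.finrank ℝ M = 4 * Module.finrank ℍᵐᵒᵖ M := by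
  rw [← Module.finrank_mul_finrank ℝ ℍᵐᵒᵖ M,
    ← (MulOpposite.opLinearEquiv ℝ : ℍ ≃ₗ[ℝ] ℍᵐᵒᵖ).finrank_eq, Quaternion.finrank_eq_four]

/-- The kernel of an operator does not depend on the scalars. -/
noncomputable def kerRestrictScalarsEquiv (A : V →L[ℍᵐᵒᵖ] U) :
    LinearMap.ker (A.restrictScalars ℝ).toLinearMap ≃ₗ[ℝ]
      LinearMap.ker (A : V →ₗ[ℍᵐᵒᵖ] U) :=
  ((LinearMap.ker (A : V →ₗ[ℍᵐᵒᵖ] U)).restrictScalarsEquiv ℝ ℍᵐᵒᵖ V).restrictScalars ℝ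

/-- The cokernel of an operator does not depend on the scalars. -/
noncomputable def cokerRestrictScalarsEquiv (A : V →L[ℍᵐᵒᵖ] U) :
    (U ⧸ LinearMap.range (A.restrictScalars ℝ).toLinearMap) ≃ₗ[ℝ]
      U ⧸ LinearMap.range (A : V →ₗ[ℍᵐᵒᵖ] U) :=
  (Submodule.Quotient.restrictScalarsEquiv ℝ
    (LinearMap.range (A : V →ₗ[ℍᵐᵒᵖ] U))).restrictScalars ℝ

theorem isFredholm_iff_real (A : V →L[ℍᵐᵒᵖ] U) :
    IsFredholm A ↔ FiniteDimensional ℝ (LinearMap.ker (A.restrictScalars ℝ).toLinearMap) ∧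
      FiniteDimensional ℝ (U ⧸ LinearMap.range (A.restrictScalars ℝ).toLinearMap) := by
  rw [IsFredholm, finiteDimensional_iff_real, finiteDimensional_iff_real]
  exact and_congr (Module.Finite.equiv_iff (kerRestrictScalarsEquiv A)).symm
    (Module.Finite.equiv_iff (cokerRestrictScalarsEquiv A)).symm

theorem four_mul_index (A : V →L[ℍᵐᵒᵖ] U) :
    4 * index A = (Module.finrank ℝ (LinearMap.ker (A.restrictScalars ℝ).toLinearMap) : ℤ) -
      Module.finrank ℝ (U ⧸ LinearMap.range (A.restrictScalars ℝ).toLinearMap) := by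
  rw [(kerRestrictScalarsEquiv A).finrank_eq, (cokerRestrictScalarsEquiv A).finrank_eq,
    finrank_real, finrank_real, index]
  push_cast
  ring

theorem exists_opNorm_lt_isFredholm_add [CompleteSpace V] [CompleteSpace U]
    (A : V →L[ℍᵐᵒᵖ] U) (hA : IsFredholm A) :
    ∃ c : ℝ, 0 < c ∧ ∀ S : V →L[ℍᵐᵒᵖ] U, opNorm S < c →
      IsFredholm (A + S) ∧ index (A + S) = index A := by
  obtain ⟨_, _⟩ := (isFredholm_iff_real A).1 hA
  obtain ⟨c, hc, h⟩ := (A.restrictScalars ℝ).exists_forall_finrank_ker_add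
  refine ⟨c, hc, fun S hS => ?_⟩
  obtain ⟨h1, h2, h3⟩ := h (S.restrictScalars ℝ) ((norm_restrictScalars_le_opNorm S).trans_lt hS)
  rw [← ContinuousLinearMap.restrictScalars_add] at h1 h2 h3
  refine ⟨(isFredholm_iff_real _).2 ⟨h1, h2⟩, ?_⟩
  have h4 := four_mul_index A
  have h5 := four_mul_index (A + S)
  -- Equal real indices give `4 * index (A + S) = 4 * index A`, and the 4 cancels in `ℤ`.
  omega

end QuaternionicOperator

theorem theorem6p19 {V U : Type*}
    [NormedAddCommGroup V] [RightQuaternionicInnerProductSpace V]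
    [CompleteSpace V] [TopologicalSpace.SeparableSpace V]
    [NormedAddCommGroup U] [RightQuaternionicInnerProductSpace U]
    [CompleteSpace U] [TopologicalSpace.SeparableSpace U]
    (A : V →L[ℍᵐᵒᵖ] U) (hA : QuaternionicOperator.IsFredholm A) :
    ∃ c : ℝ, 0 < c ∧ ∀ S : V →L[ℍᵐᵒᵖ] U, QuaternionicOperator.opNorm S < c →
      QuaternionicOperator.IsFredholm (A + S) ∧
        QuaternionicOperator.index (A + S) = QuaternionicOperator.index A :=
  QuaternionicOperator.exists_opNorm_lt_isFredholm_add A hA
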